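/- A \emph{signed partition} of an integer $n$ is a pair $(\pi,\nu)$ of ordinary (possibly empty) integer partitions with $|\pi|-|\nu|=n$, where $|\cdot|$ denotes the sum of the parts; the members of $\pi$ are its \emph{positive parts}, the members of $\nu$ (recorded as positive integers) are its \emph{negative parts}, and $\ell^+$ denotes the number of positive parts. For an integer $n\ge 0$, let $LG_1(n)$ denote the number of partitions of $n$ in which consecutive parts (in decreasing order) differ by at least $2$, and by at least $4$ if both of them are odd. Let $LG'_{-1}(n)$ denote the number of signed partitions of $n$ in which the positive parts are distinct and even, and the negative parts are distinct, congruent to $1 \pmod 4$, and at most $2\ell^+$. Then for every integer $n\ge 0$ the number $LG'_{-1}(n)$ is finite and $$LG_1(n)=LG'_{-1}(n).$$ -/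

import Mathlib

/-- A signed partition of the integer `n`: a pair `(π, ν)` of ordinary (possibly empty) partitions
with `|π| - |ν| = n`. The parts of `π` are the positive parts, those of `ν` the negative parts. -/
structure SignedPartition (n : ℤ) where
  /-- the size `|π|` -/
  posSize : ℕ
  /-- the size `|ν|` -/
  negSize : ℕ
  /-- the partition `π` of positive parts -/
  pos : Nat.Partition posSize
  /-- the partition `ν` of negative parts (recorded by absolute value) -/
  neg : Nat.Partition negSize
  size_sub_size : (posSize : ℤ) - (negSize : ℤ) = n

namespace SignedPartition

/-- The number `ℓ⁺` of positive parts, counted with multiplicity. -/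
def numPos {n : ℤ} (σ : SignedPartition n) : ℕ := Multiset.card σ.pos.parts

end SignedPartition

/-- The partitions of `n` in which the difference between (consecutive) parts is at least `2`, and
at least `4` if the two parts are odd. The parts are listed in weakly decreasing order. -/
def LG1Set (n : ℕ) : Set (Nat.Partition n) :=
  {p | (p.parts.sort (· ≥ ·)).IsChain
    (fun a b => b + 2 ≤ a ∧ (Odd a → Odd b → b + 4 ≤ a))}

/-- `LG₁(n)`. -/
noncomputable def LG1 (n : ℕ) : ℕ := (LG1Set n).ncard

/-- The signed partitions of `n` whose positive parts are distinct and even, and whose negative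
parts are distinct, congruent to `1` modulo `4`, and at most `2ℓ⁺`. -/
def LGNeg1'Set (n : ℤ) : Set (SignedPartition n) :=
  {σ | σ.pos.parts.Nodup ∧ (∀ a ∈ σ.pos.parts, Even a) ∧
    σ.neg.parts.Nodup ∧ (∀ b ∈ σ.neg.parts, b ≡ 1 [MOD 4]) ∧
    (∀ b ∈ σ.neg.parts, b ≤ 2 * σ.numPos)}

/-- `LG'₋₁(n)`. -/
noncomputable def LGNeg1' (n : ℤ) : ℕ := (LGNeg1'Set n).ncard

/-! Both sides are refined by a number `k`: the number of odd parts for `LG1`, the number of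
negative parts for the signed partitions. For fixed `k`, but summed over the number `m` of
(positive) parts, the two counts agree, because both satisfy F_{k+1}(n) = F_{k+1}(n - 4k - 4) +
F_k(n - 4k - 1), vanish for n < 0, and for k = 0 count sets of positive even integers.

On both sides the count for given `m` is expressed through `evenCount m` and `shiftSum`, which
multiplies a generating function by the `k`-th elementary symmetric function of q^a, q^(a+d), …,
q^(a+(r-1)d). Gap sets use the exponents 1, 3, …, 2m - 1 if the part 1 is excluded, and -1, 1, …, 2m
- 3 if it is allowed; translating exponents by 4 gives the recurrence (`gapCount_shift`,
`sum_gapCount_rec`). The negative parts use the exponents -1, -5, -9, …; there the recurrence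
(`signedCount_rec`) comes from pairing adjacent values of `m` in two ways and applying
`evenCount_succ`. All sums over `m` are finite because the counts vanish once `m` exceeds `n`. -/

open Finset

/-! ### Elementary symmetric shifts -/

/-- The sum of `f (x - ∑ j ∈ B, (a + d * j))` over the `k`-element subsets `B` of `range r`. -/
def shiftSum (a d : ℤ) : ℕ → ℕ → (ℤ → ℕ) → ℤ → ℕ
  | _, 0, f, x => f x
  | 0, _ + 1, _, _ => 0
  | r + 1, k + 1, f, x => shiftSum a d r (k + 1) f x + shiftSum a d r k f (x - (a + d * r))

section ShiftSum

variable (a d : ℤ)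

@[simp] theorem shiftSum_zero_right (r : ℕ) (f : ℤ → ℕ) (x : ℤ) :
    shiftSum a d r 0 f x = f x := by
  cases r <;> rfl

@[simp] theorem shiftSum_zero_succ (k : ℕ) (f : ℤ → ℕ) (x : ℤ) :
    shiftSum a d 0 (k + 1) f x = 0 := rfl

theorem shiftSum_succ_succ (r k : ℕ) (f : ℤ → ℕ) (x : ℤ) :
    shiftSum a d (r + 1) (k + 1) f x
      = shiftSum a d r (k + 1) f x + shiftSum a d r k f (x - (a + d * r)) := rfl

/-- Splitting the subsets according to whether they contain `0`. -/
theorem shiftSum_succ_succ' (r k : ℕ) (f : ℤ → ℕ) (x : ℤ) :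
    shiftSum a d (r + 1) (k + 1) f x
      = shiftSum a d r (k + 1) f (x - d * (k + 1)) + shiftSum a d r k f (x - d * k - a) := by
  induction r generalizing k x with
  | zero =>
    cases k with
    | zero => simp [shiftSum_succ_succ]
    | succ k => simp [shiftSum_succ_succ]
  | succ r ih =>
    rw [shiftSum_succ_succ, ih, shiftSum_succ_succ a d r k f (x - d * (k + 1))]
    cases k with
    | zero =>
      simp only [shiftSum_zero_right]
      push_cast
      ring_nf
    | succ k =>
      rw [ih, shiftSum_succ_succ a d r k f]
      push_cast
      ring_nf

/-- Lets a recurrence for `f`, in practice `evenCount_succ`, be applied under `shiftSum`. -/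
theorem shiftSum_add_of_add {f g h : ℤ → ℕ} {t : ℤ} (hf : ∀ x, f (x + t) = g x + h x)
    (r k : ℕ) (x : ℤ) :
    shiftSum a d r k f (x + t) = shiftSum a d r k g x + shiftSum a d r k h x := by
  induction r generalizing k x with
  | zero => cases k <;> simp [hf]
  | succ r ih =>
    cases k with
    | zero => simp [hf]
    | succ k =>
      simp only [shiftSum_succ_succ]
      rw [ih, show x + t - (a + d * r) = x - (a + d * r) + t by ring, ih]
      ring

theorem shiftSum_eq_sum (r k : ℕ) (f : ℤ → ℕ) (x : ℤ) :
    shiftSum a d r k f x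
      = ∑ B ∈ powersetCard k (range r), f (x - ∑ j ∈ B, (a + d * (j : ℤ))) := by
  induction r generalizing k x with
  | zero =>
    cases k with
    | zero => simp
    | succ k =>
      rw [shiftSum_zero_succ, powersetCard_eq_empty.2 (by simp), sum_empty]
  | succ r ih =>
    cases k with
    | zero => simp
    | succ k =>
      rw [range_add_one, powersetCard_succ_insert (by simp), sum_union, sum_image,
        shiftSum_succ_succ, ih, ih]
      · congr 1
        refine sum_congr rfl fun B hB => ?_
        have hr : r ∉ B := fun h => by
          simpa using (mem_powersetCard.1 hB).1 h
        rw [sum_insert hr]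
        congr 1
        ring
      · intro B hB C hC h
        have hB' : r ∉ B := fun h => by simpa using (mem_powersetCard.1 hB).1 h
        have hC' : r ∉ C := fun h => by simpa using (mem_powersetCard.1 hC).1 h
        rw [← erase_insert hB', ← erase_insert hC', h]
      · rw [Finset.disjoint_left]
        intro B hB hB'
        obtain ⟨C, -, rfl⟩ := mem_image.1 hB'
        simpa using (mem_powersetCard.1 hB).1 (mem_insert_self r C)

end ShiftSum

theorem shiftSum_eq_zero_of_neg {f : ℤ → ℕ} (hf : ∀ y < 0, f y = 0) (r k : ℕ) {x : ℤ}
    (hx : x < 0) : shiftSum 1 2 r k f x = 0 := by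
  induction r generalizing k x with
  | zero => cases k <;> simp [hf x hx]
  | succ r ih =>
    cases k with
    | zero => simp [hf x hx]
    | succ k => rw [shiftSum_succ_succ, ih _ hx, ih _ (by omega)]

/-- All `r` shifts 1, 5, …, 4r - 3 together raise the argument by r(2r - 1), which is the most any
subset can do. -/
theorem shiftSum_eq_zero_of_lt {f : ℤ → ℕ} {t : ℤ} (hf : ∀ y < t, f y = 0) (r k : ℕ) {x : ℤ}
    (hx : x + r * (2 * r - 1) < t) : shiftSum (-1) (-4) r k f x = 0 := by
  induction r generalizing k x with
  | zero => cases k <;> simp_all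
  | succ r ih =>
    have hr : (0 : ℤ) ≤ r := by positivity
    push_cast at hx
    cases k with
    | zero =>
      rw [shiftSum_zero_right]
      exact hf x (by nlinarith)
    | succ k => rw [shiftSum_succ_succ, ih _ (by nlinarith), ih _ (by nlinarith)]

/-! ### Gap sets and removal of the smallest part -/

/-- A finite set of positive integers whose distinct elements differ by at least `2`, and by at
least `4` if both are odd. -/
def IsGapSet (S : Finset ℕ) : Prop :=
  0 ∉ S ∧ ∀ a ∈ S, a + 1 ∉ S ∧ (Odd a → a + 2 ∉ S)

/-- The gap sets with `m` elements, of which `k` are odd, and with sum `n`. -/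
def gapFamily (m k : ℕ) (n : ℤ) : Set (Finset ℕ) :=
  {S | IsGapSet S ∧ #S = m ∧ #{a ∈ S | Odd a} = k ∧ ((∑ a ∈ S, a : ℕ) : ℤ) = n}

/-- The members of `gapFamily m k n` that do not contain `1`. -/
def gapFamilyTwo (m k : ℕ) (n : ℤ) : Set (Finset ℕ) :=
  {S | S ∈ gapFamily m k n ∧ 1 ∉ S}

theorem finite_setOf_sum_eq (n : ℤ) : {S : Finset ℕ | ((∑ a ∈ S, a : ℕ) : ℤ) = n}.Finite := by
  refine ((range (n.toNat + 1)).powerset.finite_toSet).subset fun S hS => ?_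
  simp only [coe_powerset, Set.mem_preimage, Set.mem_powerset_iff, coe_subset]
  intro a ha
  have h := single_le_sum (f := fun a : ℕ => a) (fun _ _ => Nat.zero_le _) ha
  simp only [Set.mem_ofPred_eq] at hS
  rw [Finset.mem_range]
  omega

theorem gapFamily_finite (m k : ℕ) (n : ℤ) : (gapFamily m k n).Finite :=
  (finite_setOf_sum_eq n).subset fun _ h => h.2.2.2

theorem gapFamilyTwo_finite (m k : ℕ) (n : ℤ) : (gapFamilyTwo m k n).Finite :=
  (gapFamily_finite m k n).subset fun _ h => h.1

/-- Adding `2` to every element of a finite set. -/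
def addTwo (S : Finset ℕ) : Finset ℕ := S.map (addRightEmbedding 2)

theorem mem_addTwo {S : Finset ℕ} {a : ℕ} : a ∈ addTwo S ↔ ∃ b ∈ S, b + 2 = a := by
  simp [addTwo]

@[simp] theorem add_two_mem_addTwo {S : Finset ℕ} {a : ℕ} : a + 2 ∈ addTwo S ↔ a ∈ S := by
  simp [mem_addTwo]

@[simp] theorem zero_notMem_addTwo {S : Finset ℕ} : 0 ∉ addTwo S := by simp [mem_addTwo]

@[simp] theorem one_notMem_addTwo {S : Finset ℕ} : 1 ∉ addTwo S := by simp [mem_addTwo]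

theorem addTwo_injective : Function.Injective addTwo := map_injective _

@[simp] theorem card_addTwo (S : Finset ℕ) : #(addTwo S) = #S := card_map _

@[simp] theorem card_odd_addTwo (S : Finset ℕ) :
    #{a ∈ addTwo S | Odd a} = #{a ∈ S | Odd a} := by
  rw [addTwo, filter_map, card_map]
  congr 1
  ext a
  simp [Nat.odd_add]

@[simp] theorem sum_addTwo (S : Finset ℕ) : ∑ a ∈ addTwo S, a = ∑ a ∈ S, a + 2 * #S := by
  simp [addTwo, sum_add_distrib, mul_comm]

theorem exists_addTwo_eq {S : Finset ℕ} (h0 : 0 ∉ S) (h1 : 1 ∉ S) : ∃ T, addTwo T = S := by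
  refine ⟨S.image (· - 2), ?_⟩
  ext a
  simp only [mem_addTwo, mem_image]
  constructor
  · rintro ⟨b, ⟨c, hc, rfl⟩, rfl⟩
    have h : 2 ≤ c := by
      by_contra! h
      interval_cases c <;> contradiction
    rwa [Nat.sub_add_cancel h]
  · intro ha
    have h : 2 ≤ a := by
      by_contra! h
      interval_cases a <;> contradiction
    exact ⟨a - 2, ⟨a, ha, rfl⟩, Nat.sub_add_cancel h⟩

theorem isGapSet_addTwo {S : Finset ℕ} (h0 : 0 ∉ S) : IsGapSet (addTwo S) ↔ IsGapSet S := by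
  simp only [IsGapSet, zero_notMem_addTwo, not_false_eq_true, true_and, h0]
  constructor
  · intro h a ha
    have := h (a + 2) (by simpa)
    rw [show a + 2 + 1 = a + 1 + 2 by ring] at this
    simpa [Nat.odd_add] using this
  · intro h a ha
    obtain ⟨b, hb, rfl⟩ := mem_addTwo.1 ha
    have := h b hb
    rw [show b + 2 + 1 = b + 1 + 2 by ring]
    simpa [Nat.odd_add] using this

theorem isGapSet_insert_one_addTwo {S : Finset ℕ} (h0 : 0 ∉ S) :
    IsGapSet (insert 1 (addTwo S)) ↔ IsGapSet S ∧ 1 ∉ S := by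
  rw [← isGapSet_addTwo h0]
  constructor
  · intro h
    have h1 := (h.2 1 (by simp)).2 (by decide)
    refine ⟨⟨by simp, fun a ha => ?_⟩, fun h => h1 ?_⟩
    · have := h.2 a (by simp [ha])
      exact ⟨fun h => this.1 (by simp [h]), fun o h => this.2 o (by simp [h])⟩
    · simp only [mem_insert]
      right
      simpa using h
  · rintro ⟨h, h1⟩
    refine ⟨by simp, fun a ha => ?_⟩
    rcases mem_insert.1 ha with rfl | ha
    · refine ⟨?_, fun _ => ?_⟩
      · simpa using (add_two_mem_addTwo (a := 0)).not.2 h0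
      · simpa using (add_two_mem_addTwo (a := 1)).not.2 h1
    · have := h.2 a ha
      obtain ⟨b, hb, rfl⟩ := mem_addTwo.1 ha
      simpa using this

theorem isGapSet_insert_two_addTwo {S : Finset ℕ} (h0 : 0 ∉ S) :
    IsGapSet (insert 2 (addTwo S)) ↔ IsGapSet S ∧ 1 ∉ S := by
  rw [← isGapSet_addTwo h0]
  constructor
  · intro h
    have h1 := (h.2 2 (by simp)).1
    refine ⟨⟨by simp, fun a ha => ?_⟩, fun h => h1 ?_⟩
    · have := h.2 a (by simp [ha])
      exact ⟨fun h => this.1 (by simp [h]), fun o h => this.2 o (by simp [h])⟩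
    · simp only [mem_insert]
      right
      simpa using h
  · rintro ⟨h, h1⟩
    refine ⟨by simp, fun a ha => ?_⟩
    rcases mem_insert.1 ha with rfl | ha
    · refine ⟨?_, fun o => ?_⟩
      · simpa using (add_two_mem_addTwo (a := 1)).not.2 h1
      · exact absurd o (by decide)
    · have := h.2 a ha
      obtain ⟨b, hb, rfl⟩ := mem_addTwo.1 ha
      have hb0 : b ≠ 0 := fun h => h0 (h ▸ hb)
      simpa [hb0] using this

/-- If 1 is present, then 2 and 3 are not; deleting 1 and lowering the other `m` parts by 2 leaves a
gap set without 1. -/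
theorem gapFamily_succ_succ (m k : ℕ) (n : ℤ) :
    gapFamily (m + 1) (k + 1) n = gapFamilyTwo (m + 1) (k + 1) n ∪
      (fun S => insert 1 (addTwo S)) '' gapFamilyTwo m k (n - 2 * m - 1) := by
  ext S
  constructor
  · intro hS
    by_cases h1 : 1 ∈ S
    · right
      obtain ⟨T, hT⟩ := exists_addTwo_eq (S := S.erase 1) (by simp [hS.1.1]) (by simp)
      have hST : insert 1 (addTwo T) = S := by rw [hT, insert_erase h1]
      have h2 := (hS.1.2 1 h1).1
      have h0 : 0 ∉ T := fun h => h2 (by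
        rw [← hST]; exact mem_insert_of_mem ((add_two_mem_addTwo (a := 0)).2 h))
      refine ⟨T, ?_, hST⟩
      obtain ⟨hg, hc, ho, hs⟩ := hS
      rw [← hST] at hg hc ho hs
      rw [isGapSet_insert_one_addTwo h0] at hg
      rw [filter_insert, if_pos (by decide), card_insert_of_notMem (by simp)] at ho
      rw [card_insert_of_notMem (by simp)] at hc
      rw [sum_insert (by simp)] at hs
      simp at hc ho hs
      refine ⟨⟨hg.1, hc, ho, ?_⟩, hg.2⟩
      rw [← hs, hc]
      push_cast
      ring
    · exact Or.inl ⟨hS, h1⟩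
  · rintro (hS | ⟨T, ⟨⟨hg, hc, ho, hs⟩, h1⟩, rfl⟩)
    · exact hS.1
    · refine ⟨(isGapSet_insert_one_addTwo hg.1).2 ⟨hg, h1⟩, ?_, ?_, ?_⟩
      · rw [card_insert_of_notMem (by simp)]
        simp [hc]
      · rw [filter_insert, if_pos (by decide), card_insert_of_notMem (by simp)]
        simp [ho]
      · rw [sum_insert (by simp), sum_addTwo, hc]
        push_cast at hs ⊢
        rw [hs]
        ring

theorem gapFamily_zero_right (m : ℕ) (n : ℤ) : gapFamily m 0 n = gapFamilyTwo m 0 n := by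
  ext S
  refine ⟨fun hS => ⟨hS, fun h1 => ?_⟩, fun hS => hS.1⟩
  have := hS.2.2.1
  rw [card_eq_zero, filter_eq_empty_iff] at this
  exact this h1 (by decide)

/-- All parts are lowered by 2. A part 2 would become 0 and is dropped; as it excludes 3, the result
then has no part 1. -/
theorem gapFamilyTwo_succ (m k : ℕ) (n : ℤ) :
    gapFamilyTwo (m + 1) k n = addTwo '' gapFamily (m + 1) k (n - 2 * m - 2) ∪
      (fun S => insert 2 (addTwo S)) '' gapFamilyTwo m k (n - 2 * m - 2) := by
  ext S
  constructor
  · rintro ⟨⟨hg, hc, ho, hs⟩, h1⟩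
    by_cases h2 : 2 ∈ S
    · right
      obtain ⟨T, hT⟩ := exists_addTwo_eq (S := S.erase 2) (by simp [hg.1]) (by simp [h1])
      have hST : insert 2 (addTwo T) = S := by rw [hT, insert_erase h2]
      have hn2 : 2 ∉ addTwo T := by simp [hT]
      have h0 : 0 ∉ T := fun h => hn2 ((add_two_mem_addTwo (a := 0)).2 h)
      refine ⟨T, ?_, hST⟩
      rw [← hST] at hg hc ho hs
      rw [isGapSet_insert_two_addTwo h0] at hg
      rw [filter_insert, if_neg (by decide)] at ho
      rw [card_insert_of_notMem hn2] at hc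
      rw [sum_insert hn2] at hs
      simp at hc ho hs
      refine ⟨⟨hg.1, hc, ho, ?_⟩, hg.2⟩
      rw [← hs, hc]
      push_cast
      ring
    · left
      obtain ⟨T, rfl⟩ := exists_addTwo_eq hg.1 h1
      have h0 : 0 ∉ T := fun h => h2 ((add_two_mem_addTwo (a := 0)).2 h)
      simp at hc ho hs
      refine ⟨T, ⟨(isGapSet_addTwo h0).1 hg, hc, ho, ?_⟩, rfl⟩
      rw [← hs, hc]
      push_cast
      ring
  · rintro (⟨T, ⟨hg, hc, ho, hs⟩, rfl⟩ | ⟨T, ⟨⟨hg, hc, ho, hs⟩, h1⟩, rfl⟩)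
    · refine ⟨⟨(isGapSet_addTwo hg.1).2 hg, by simp [hc], by simp [ho], ?_⟩, by simp⟩
      rw [sum_addTwo, hc]
      push_cast at hs ⊢
      rw [hs]
      ring
    · have hn2 : 2 ∉ addTwo T := fun h => hg.1 ((add_two_mem_addTwo (a := 0)).1 h)
      refine ⟨⟨(isGapSet_insert_two_addTwo hg.1).2 ⟨hg, h1⟩, ?_, ?_, ?_⟩, by simp⟩
      · rw [card_insert_of_notMem hn2]
        simp [hc]
      · rw [filter_insert, if_neg (by decide)]
        simp [ho]
      · rw [sum_insert hn2, sum_addTwo, hc]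
        push_cast at hs ⊢
        rw [hs]
        ring

/-! ### Recurrences for the counts of gap sets -/

/-- The number of gap sets with `m` elements, of which `k` are odd, and with sum `n`. -/
noncomputable def gapCount (m k : ℕ) (n : ℤ) : ℕ := (gapFamily m k n).ncard

/-- The number of gap sets as in `gapCount` that do not contain `1`. -/
noncomputable def gapCountTwo (m k : ℕ) (n : ℤ) : ℕ := (gapFamilyTwo m k n).ncard

theorem gapCount_zero_right (m : ℕ) (n : ℤ) : gapCount m 0 n = gapCountTwo m 0 n := by
  rw [gapCount, gapFamily_zero_right, gapCountTwo]

theorem gapCount_succ_succ (m k : ℕ) (n : ℤ) :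
    gapCount (m + 1) (k + 1) n
      = gapCountTwo (m + 1) (k + 1) n + gapCountTwo m k (n - 2 * m - 1) := by
  rw [gapCount, gapFamily_succ_succ, Set.ncard_union_eq _ (gapFamilyTwo_finite _ _ _)
    ((gapFamilyTwo_finite _ _ _).image _), Set.ncard_image_of_injective]
  · rfl
  · intro S T h
    apply addTwo_injective
    rw [← erase_insert (one_notMem_addTwo (S := S)), ← erase_insert (one_notMem_addTwo (S := T))]
    exact congrArg (·.erase 1) h
  · rw [Set.disjoint_left]
    rintro _ hS ⟨T, -, rfl⟩
    exact hS.2 (mem_insert_self _ _)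

theorem gapCountTwo_succ (m k : ℕ) (n : ℤ) :
    gapCountTwo (m + 1) k n
      = gapCount (m + 1) k (n - 2 * m - 2) + gapCountTwo m k (n - 2 * m - 2) := by
  rw [gapCountTwo, gapFamilyTwo_succ, Set.ncard_union_eq _ ((gapFamily_finite _ _ _).image _)
    ((gapFamilyTwo_finite _ _ _).image _), Set.ncard_image_of_injective _ addTwo_injective,
    Set.InjOn.ncard_image]
  · rfl
  · intro S hS T hT h
    have hS2 : 2 ∉ addTwo S := fun h => hS.1.1.1 ((add_two_mem_addTwo (a := 0)).1 h)
    have hT2 : 2 ∉ addTwo T := fun h => hT.1.1.1 ((add_two_mem_addTwo (a := 0)).1 h)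
    apply addTwo_injective
    rw [← erase_insert hS2, ← erase_insert hT2]
    exact congrArg (·.erase 2) h
  · rw [Set.disjoint_left]
    rintro _ ⟨S, hS, rfl⟩ ⟨T, -, h⟩
    have : 2 ∈ addTwo S := h ▸ mem_insert_self _ _
    exact hS.1.1 ((add_two_mem_addTwo (a := 0)).1 this)

theorem gapCount_eq_zero_of_neg (m k : ℕ) {n : ℤ} (hn : n < 0) : gapCount m k n = 0 := by
  rw [gapCount, Set.ncard_eq_zero (gapFamily_finite _ _ _), Set.eq_empty_iff_forall_notMem]
  rintro S ⟨-, -, -, h⟩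
  omega

theorem gapCountTwo_eq_zero_of_neg (m k : ℕ) {n : ℤ} (hn : n < 0) : gapCountTwo m k n = 0 := by
  rw [gapCountTwo, Set.ncard_eq_zero (gapFamilyTwo_finite _ _ _),
    Set.eq_empty_iff_forall_notMem]
  rintro S ⟨⟨-, -, -, h⟩, -⟩
  omega

theorem gapFamily_zero_succ (k : ℕ) (n : ℤ) : gapFamily 0 (k + 1) n = ∅ := by
  rw [Set.eq_empty_iff_forall_notMem]
  rintro S ⟨-, h, h', -⟩
  rw [card_eq_zero] at h
  simp [h] at h'

theorem gapCount_zero_succ (k : ℕ) (n : ℤ) : gapCount 0 (k + 1) n = 0 := by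
  rw [gapCount, gapFamily_zero_succ, Set.ncard_empty]

theorem gapCountTwo_zero_succ (k : ℕ) (n : ℤ) : gapCountTwo 0 (k + 1) n = 0 := by
  rw [gapCountTwo, Set.ncard_eq_zero (gapFamilyTwo_finite _ _ _),
    Set.eq_empty_iff_forall_notMem]
  rintro S ⟨h, -⟩
  rw [gapFamily_zero_succ] at h
  exact h

/-- The number of sets of `m` positive even integers with sum `n`. -/
noncomputable def evenCount (m : ℕ) (n : ℤ) : ℕ := gapCount m 0 n

theorem evenCount_succ (m : ℕ) (n : ℤ) :
    evenCount (m + 1) (n + 2 * (m + 1)) = evenCount (m + 1) n + evenCount m n := by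
  rw [evenCount, gapCount_zero_right, gapCountTwo_succ, ← gapCount_zero_right]
  simp only [evenCount]
  ring_nf

/-- The least possible sum is 2 + 4 + … + 2m. -/
theorem evenCount_eq_zero_of_lt (m : ℕ) {n : ℤ} (hn : n < m * (m + 1)) : evenCount m n = 0 := by
  induction m generalizing n with
  | zero => exact gapCount_eq_zero_of_neg _ _ (by simpa using hn)
  | succ m ih =>
    -- The recurrence lowers the integer `n`, so the induction runs on a natural strict upper bound
    -- `N` of `n`; negative `n` is the base case.
    obtain ⟨N, hN⟩ : ∃ N : ℕ, n < N := ⟨(n + 1).toNat, by omega⟩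
    induction N using Nat.strong_induction_on generalizing n with
    | _ N ihN =>
      rcases lt_or_ge n 0 with h | h
      · exact gapCount_eq_zero_of_neg _ _ h
      have hrec := evenCount_succ m (n - 2 * (m + 1))
      rw [sub_add_cancel] at hrec
      push_cast at hn
      rw [hrec, ih (by nlinarith), ihN (N - 1) (by omega) (by push_cast; nlinarith) (by omega)]

/-- Both sides obey the recurrence of removing the smallest part. In generating functions: e_k(q,
q^3, …, q^(2m-1)) times that of `m` even parts. -/
theorem gapCountTwo_eq_shiftSum (m k : ℕ) (n : ℤ) :
    gapCountTwo m k n = shiftSum 1 2 m k (evenCount m) n := by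
  have hneg (m : ℕ) : ∀ y < 0, evenCount m y = 0 := fun y hy => gapCount_eq_zero_of_neg _ _ hy
  cases k with
  | zero => rw [shiftSum_zero_right, evenCount, gapCount_zero_right]
  | succ k =>
    induction m generalizing k n with
    | zero => rw [gapCountTwo_zero_succ, shiftSum_zero_succ]
    | succ m ih =>
      obtain ⟨N, hN⟩ : ∃ N : ℕ, n < N := ⟨(n + 1).toNat, by omega⟩
      induction N using Nat.strong_induction_on generalizing n with
      | _ N ihN =>
        rcases lt_or_ge n 0 with h | h
        · rw [gapCountTwo_eq_zero_of_neg _ _ h, shiftSum_eq_zero_of_neg (hneg _) _ _ h]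
        have hs := shiftSum_add_of_add 1 2 (evenCount_succ m) (m + 1) (k + 1) (n - 2 * (m + 1))
        rw [sub_add_cancel] at hs
        rw [hs, gapCountTwo_succ, gapCount_succ_succ,
          ihN (N - 1) (by omega) _ (by omega), ih, shiftSum_succ_succ 1 2 m k (evenCount m)]
        have hk (x : ℤ) : gapCountTwo m k x = shiftSum 1 2 m k (evenCount m) x := by
          cases k with
          | zero => rw [shiftSum_zero_right, evenCount, gapCount_zero_right]
          | succ k => exact ih _ _
        rw [hk]
        ring_nf

/-- Allowing the part 1 replaces the exponents 1, 3, …, 2m + 1 by -1, 1, …, 2m - 1; the two terms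
record whether -1 is chosen. -/
theorem gapCount_succ_succ_eq_shiftSum (m k : ℕ) (n : ℤ) :
    gapCount (m + 1) (k + 1) n = shiftSum 1 2 m (k + 1) (evenCount (m + 1)) n +
      shiftSum 1 2 m k (evenCount (m + 1)) (n + 1) := by
  have hs := shiftSum_add_of_add 1 2 (evenCount_succ m) m k (n - 2 * m - 1)
  rw [gapCount_succ_succ, gapCountTwo_eq_shiftSum, gapCountTwo_eq_shiftSum, shiftSum_succ_succ,
    show n + 1 = n - 2 * m - 1 + 2 * (m + 1) by ring, hs]
  ring_nf

/-- The right side chooses k + 1 of the exponents 1, 3, …, 2m + 1. Apart from 1, these are -1, 1, …,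
2m - 3 raised by 4; omitting 1 costs 4(k + 1), choosing it costs 4k + 1. -/
theorem gapCount_shift (m k : ℕ) (n : ℤ) :
    gapCount m (k + 1) (n - 4 * k - 4) + gapCount m k (n - 4 * k - 1)
      = gapCountTwo m (k + 1) n + gapCountTwo m k (n - 2 * m - 1) := by
  rw [gapCountTwo_eq_shiftSum, gapCountTwo_eq_shiftSum,
    show n - 2 * m - 1 = n - (1 + 2 * m) by ring, ← shiftSum_succ_succ]
  cases m with
  | zero =>
    rw [gapCount_zero_succ, shiftSum_succ_succ]
    cases k with
    | zero => simp [evenCount]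
    | succ k => simp [gapCount_zero_succ]
  | succ m =>
    rw [shiftSum_succ_succ', shiftSum_succ_succ', gapCount_succ_succ_eq_shiftSum]
    cases k with
    | zero =>
      simp only [shiftSum_zero_right, evenCount]
      push_cast
      ring_nf
    | succ k =>
      rw [shiftSum_succ_succ', gapCount_succ_succ_eq_shiftSum]
      push_cast
      ring_nf

theorem sum_gapCount_rec (M k : ℕ) {n : ℤ} (hn : n < M) :
    ∑ m ∈ range M, gapCount m (k + 1) n = ∑ m ∈ range M, gapCount m (k + 1) (n - 4 * k - 4) +
      ∑ m ∈ range M, gapCount m k (n - 4 * k - 1) := by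
  rw [← sum_add_distrib]
  simp only [gapCount_shift]
  cases M with
  | zero => simp
  | succ M =>
    -- Reindexing by `gapCount_succ_succ` leaves one boundary term, at `m = M`, whose argument is
    -- negative because `n < M`.
    rw [sum_range_succ', sum_add_distrib, sum_range_succ', sum_range_succ _ M]
    simp only [gapCount_succ_succ, sum_add_distrib]
    rw [gapCount_zero_succ, gapCountTwo_zero_succ,
      gapCountTwo_eq_zero_of_neg M k (by push_cast at hn; omega)]
    ring

theorem sum_range_two_mul (f : ℕ → ℕ) (R : ℕ) :
    ∑ m ∈ range (2 * R), f m = ∑ r ∈ range R, (f (2 * r) + f (2 * r + 1)) := by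
  induction R with
  | zero => simp
  | succ R ih => rw [mul_add, mul_one, sum_range_succ, sum_range_succ, ih, sum_range_succ, add_assoc]

/-! ### The same recurrence for signed partitions -/

/-- The number of pairs of a set of `m < M` positive even integers and a
`k`-element set of integers `4 * j + 1` with `j < (m + 1) / 2`, the first sum exceeding the second
by `n`. -/
noncomputable def signedCount (M k : ℕ) (n : ℤ) : ℕ :=
  ∑ m ∈ range M, shiftSum (-1) (-4) ((m + 1) / 2) k (evenCount m) n

/-- The variant of `signedCount` with the bound `j < m / 2`. -/
noncomputable def signedCountLow (M k : ℕ) (n : ℤ) : ℕ :=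
  ∑ m ∈ range M, shiftSum (-1) (-4) (m / 2) k (evenCount m) n

/-- The two bounds differ only for m = 2r + 1, by the index j = r. Choosing it puts `evenCount (2r +
1)` at an argument where `evenCount_succ` splits it into the terms for 2r + 1 and 2r. -/
theorem signedCount_two_mul_succ (R k : ℕ) (n : ℤ) :
    signedCount (2 * R) (k + 1) n
      = signedCountLow (2 * R) (k + 1) n + signedCountLow (2 * R) k (n - 1) := by
  simp only [signedCount, signedCountLow, sum_range_two_mul]
  rw [← sum_add_distrib]
  refine sum_congr rfl fun r _ => ?_
  rw [show (2 * r + 1) / 2 = r by omega, show (2 * r + 1 + 1) / 2 = r + 1 by omega,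
    show 2 * r / 2 = r by omega, shiftSum_succ_succ]
  have hs := shiftSum_add_of_add (-1) (-4) (evenCount_succ (2 * r)) r k (n - 1)
  rw [show n - (-1 + -4 * (r : ℤ)) = n - 1 + 2 * ((2 * r : ℕ) + 1) by push_cast; ring, hs]
  ring

/-- Here m = 2r + 1 is paired with 2r + 2: the top index is split off on the left, the index 0 on
the right, and `evenCount_succ` matches the pieces. -/
theorem signedCountLow_succ (R k : ℕ) {n : ℤ} (hn : n ≤ 2 * R) :
    signedCountLow (2 * R) (k + 1) n = signedCount (2 * R) (k + 1) (n - 4 * k - 4) := by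
  cases R with
  | zero => simp [signedCountLow, signedCount]
  | succ R =>
    have hsplit (f : ℕ → ℕ) : ∑ m ∈ range (2 * (R + 1)), f m
        = f 0 + ∑ r ∈ range R, (f (2 * r + 1) + f (2 * r + 1 + 1)) + f (2 * R + 1) := by
      rw [mul_add, mul_one, sum_range_succ, sum_range_succ', sum_range_two_mul (fun m => f (m + 1))]
      ring
    have hbot (m r : ℕ) : shiftSum (-1) (-4) (r + 1) (k + 1) (evenCount m) (n - 4 * k - 4)
        = shiftSum (-1) (-4) r (k + 1) (evenCount m) n
          + shiftSum (-1) (-4) r k (evenCount m) (n - 3) := by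
      rw [shiftSum_succ_succ']
      ring_nf
    -- The largest `m` in the range has no partner; its surplus term vanishes because `n` is too
    -- small.
    have hlast : shiftSum (-1) (-4) R k (evenCount (2 * R + 1)) (n - 3) = 0 := by
      refine shiftSum_eq_zero_of_lt (fun y hy => evenCount_eq_zero_of_lt (2 * R + 1) hy) _ _ ?_
      push_cast at hn ⊢
      nlinarith
    simp only [signedCount, signedCountLow, hsplit]
    rw [show (2 * R + 1 + 1) / 2 = R + 1 by omega, show (2 * R + 1) / 2 = R by omega, hbot, hlast,
      add_zero, Nat.zero_div, shiftSum_zero_succ, shiftSum_zero_succ]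
    congr 2
    refine sum_congr rfl fun r _ => ?_
    rw [show (2 * r + 1 + 1) / 2 = r + 1 by omega, show (2 * r + 1) / 2 = r by omega,
      show (2 * r + 1 + 1 + 1) / 2 = r + 1 by omega, hbot, hbot, shiftSum_succ_succ]
    have hs := shiftSum_add_of_add (-1) (-4) (evenCount_succ (2 * r + 1)) r k (n - 3)
    rw [show n - (-1 + -4 * (r : ℤ)) = n - 3 + 2 * ((2 * r + 1 : ℕ) + 1) by push_cast; ring, hs]
    ring

theorem signedCount_rec (R k : ℕ) {n : ℤ} (hn : n ≤ 2 * R) :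
    signedCount (2 * R) (k + 1) n = signedCount (2 * R) (k + 1) (n - 4 * k - 4) +
      signedCount (2 * R) k (n - 4 * k - 1) := by
  rw [signedCount_two_mul_succ, signedCountLow_succ R k hn]
  cases k with
  | zero => simp [signedCount, signedCountLow]
  | succ k =>
    rw [signedCountLow_succ R k (by omega)]
    push_cast
    ring_nf

/-- The positive parts sum to at least m(m + 1), the negative ones to at most half of that. This
bounds `m` in terms of `n` and so yields finiteness. -/
theorem shiftSum_evenCount_eq_zero (m k : ℕ) {n : ℤ} (hn : 2 * n < m * (m + 1)) :
    shiftSum (-1) (-4) ((m + 1) / 2) k (evenCount m) n = 0 := by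
  refine shiftSum_eq_zero_of_lt (fun y hy => evenCount_eq_zero_of_lt m hy) _ _ ?_
  have h : (2 * ((m + 1) / 2 : ℕ) : ℤ) ≤ m + 1 := by exact_mod_cast Nat.mul_div_le (m + 1) 2
  set r : ℤ := (((m + 1) / 2 : ℕ) : ℤ)
  have hr : 0 ≤ r := by positivity
  have hm : (0 : ℤ) ≤ m := by positivity
  nlinarith [mul_nonneg hm (sub_nonneg.2 h), mul_nonneg hr (sub_nonneg.2 h)]

theorem signedCount_eq_zero_of_neg (M k : ℕ) {n : ℤ} (hn : n < 0) : signedCount M k n = 0 := by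
  refine sum_eq_zero fun m _ => shiftSum_evenCount_eq_zero m k ?_
  have : (0 : ℤ) ≤ m * (m + 1) := by positivity
  omega

theorem signedCount_eq_sum_gapCount (R k : ℕ) {n : ℤ} (hn : n < 2 * R) :
    signedCount (2 * R) k n = ∑ m ∈ range (2 * R), gapCount m k n := by
  induction k generalizing n with
  | zero => simp [signedCount, evenCount]
  | succ k ih =>
    obtain ⟨N, hN⟩ : ∃ N : ℕ, n < N := ⟨(n + 1).toNat, by omega⟩
    induction N using Nat.strong_induction_on generalizing n with
    | _ N ihN =>
      rcases lt_or_ge n 0 with h | h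
      · rw [signedCount_eq_zero_of_neg _ _ h,
          sum_eq_zero fun m _ => gapCount_eq_zero_of_neg m _ h]
      rw [signedCount_rec R k hn.le, sum_gapCount_rec (2 * R) k (by push_cast; omega),
        ih (by omega), ihN (N - 1) (by omega) (by omega) (by omega)]

/-! ### From partitions to gap sets -/

/-- The gap sets with sum `n`. -/
def gapSets (n : ℕ) : Set (Finset ℕ) := {S | IsGapSet S ∧ ∑ a ∈ S, a = n}

theorem card_le_sum_of_zero_notMem {S : Finset ℕ} (h : 0 ∉ S) : #S ≤ ∑ a ∈ S, a := by
  rw [card_eq_sum_ones]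
  exact sum_le_sum fun a ha => Nat.one_le_iff_ne_zero.2 fun h' => h (h' ▸ ha)

theorem ncard_gapSets {n M : ℕ} (hM : n < M) :
    (gapSets n).ncard = ∑ k ∈ range M, ∑ m ∈ range M, gapCount m k n := by
  let Q : Finset (Σ _ : ℕ, Σ _ : ℕ, Finset ℕ) := (range M).sigma fun k => (range M).sigma fun m =>
    (gapFamily_finite m k n).toFinset
  have hQ : #Q = ∑ k ∈ range M, ∑ m ∈ range M, gapCount m k n := by
    simp only [Q, card_sigma, gapCount, Set.ncard_eq_toFinset_card _ (gapFamily_finite _ _ _)]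
  have himage : gapSets n = (fun q : Σ _ : ℕ, Σ _ : ℕ, Finset ℕ => q.2.2) '' (Q : Set _) := by
    ext S
    constructor
    · rintro ⟨hg, hs⟩
      have h1 := card_le_sum_of_zero_notMem hg.1
      have h2 := card_filter_le S (fun a => Odd a)
      refine ⟨⟨#{a ∈ S | Odd a}, #S, S⟩, ?_, rfl⟩
      simp only [Q, mem_coe, mem_sigma, mem_range, Set.Finite.mem_toFinset]
      exact ⟨by omega, by omega, hg, rfl, rfl, by rw [hs]⟩
    · rintro ⟨⟨k, m, S⟩, hq, rfl⟩
      simp only [Q, mem_coe, mem_sigma, mem_range, Set.Finite.mem_toFinset] at hq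
      exact ⟨hq.2.2.1, by exact_mod_cast hq.2.2.2.2.2⟩
  rw [himage, Set.InjOn.ncard_image, Set.ncard_coe_finset, hQ]
  rintro ⟨k, m, S⟩ hS ⟨k', m', S'⟩ hS' (rfl : S = S')
  simp only [Q, mem_coe, mem_sigma, mem_range, Set.Finite.mem_toFinset] at hS hS'
  obtain ⟨-, -, -, rfl, rfl, -⟩ := hS
  obtain ⟨-, -, -, rfl, rfl, -⟩ := hS'
  rfl

theorem isChain_sort_iff {s : Multiset ℕ} (h0 : 0 ∉ s) :
    (s.sort (· ≥ ·)).IsChain (fun a b => b + 2 ≤ a ∧ (Odd a → Odd b → b + 4 ≤ a)) ↔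
      s.Nodup ∧ IsGapSet s.toFinset := by
  let R : ℕ → ℕ → Prop := fun a b => b + 2 ≤ a ∧ (Odd a → Odd b → b + 4 ≤ a)
  have : IsTrans ℕ R := ⟨fun a b c h h' => by dsimp only [R] at *; omega⟩
  change List.IsChain R _ ↔ _
  rw [List.isChain_iff_pairwise]
  have hsort : ((s.sort (· ≥ ·) : List ℕ) : Multiset ℕ) = s := Multiset.sort_eq s _
  constructor
  · intro h
    have hmem {a b : ℕ} (ha : a ∈ s) (hb : b ∈ s) (hab : a ≠ b) : R a b ∨ R b a := by
      have h' : List.Pairwise (fun a b => R a b ∨ R b a) (s.sort (· ≥ ·)) :=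
        h.imp fun h => Or.inl h
      have : Std.Symm fun a b => R a b ∨ R b a := ⟨fun _ _ => Or.symm⟩
      exact h'.forall (by simpa using ha) (by simpa using hb) hab
    refine ⟨?_, by simpa using h0, fun a ha => ⟨fun hb => ?_, fun o hb => ?_⟩⟩
    · rw [← hsort, Multiset.coe_nodup]
      refine h.imp fun {a b} (h : R a b) (hab : a = b) => ?_
      have := h.1
      omega
    · have := hmem (by simpa using ha) (by simpa using hb) (by omega)
      dsimp only [R] at this
      omega
    · have := hmem (by simpa using ha) (by simpa using hb) (by omega)
      have o' : Odd (a + 2) := by simpa [Nat.odd_add] using o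
      rcases this with h | h
      · have := h.1
        omega
      · have := h.2 o' o
        omega
  · rintro ⟨hn, -, hg⟩
    rw [← hsort, Multiset.coe_nodup] at hn
    have hge : List.Pairwise (· ≥ ·) (s.sort (· ≥ ·)) := Multiset.pairwise_sort s _
    refine (hge.and hn).imp_of_mem fun {a b} ha hb hab => ?_
    have ha' : a ∈ s.toFinset := by simpa using ha
    have h := hg b (by simpa using hb)
    have h1 : a ≠ b + 1 := fun h' => h.1 (h' ▸ ha')
    refine ⟨by omega, fun o o' => ?_⟩
    have h2 : a ≠ b + 2 := fun h' => h.2 o' (h' ▸ ha')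
    -- For odd parts the remaining gap 3 is excluded by parity alone.
    have h3 : a ≠ b + 3 := by
      rintro rfl
      rw [Nat.odd_iff] at o o'
      omega
    omega

theorem Multiset.sum_toFinset_of_nodup {s : Multiset ℕ} (h : s.Nodup) :
    ∑ a ∈ s.toFinset, a = s.sum := by
  rw [Finset.sum, Multiset.toFinset_val, h.dedup, Multiset.map_id']

theorem LG1_eq_ncard_gapSets (n : ℕ) : LG1 n = (gapSets n).ncard := by
  have h0 (p : Nat.Partition n) : 0 ∉ p.parts := fun h => (p.parts_pos h).ne' rfl
  have himage : gapSets n = (fun p : Nat.Partition n => p.parts.toFinset) '' LG1Set n := by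
    ext S
    constructor
    · rintro ⟨hg, hs⟩
      refine ⟨⟨S.val, fun {a} ha => Nat.pos_of_ne_zero fun h => hg.1 (h ▸ ha), ?_⟩, ?_, ?_⟩
      · rw [← hs, Finset.sum, Multiset.map_id']
      · exact (isChain_sort_iff hg.1).2 ⟨S.nodup, by simpa using hg⟩
      · simp
    · rintro ⟨p, hp, rfl⟩
      have h := (isChain_sort_iff (h0 p)).1 hp
      exact ⟨h.2, by rw [Multiset.sum_toFinset_of_nodup h.1, p.parts_sum]⟩
  rw [himage, Set.InjOn.ncard_image, LG1]
  intro p hp q hq h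
  have hp' := ((isChain_sort_iff (h0 p)).1 hp).1
  have hq' := ((isChain_sort_iff (h0 q)).1 hq).1
  ext1
  rw [← hp'.dedup, ← hq'.dedup, ← Multiset.toFinset_val, ← Multiset.toFinset_val]
  exact congrArg Finset.val h

/-! ### From signed partitions to pairs of sets -/

/-- The pairs of a set `A` of positive even integers and a set `B` of natural numbers less than
`(#A + 1) / 2` for which the sum of `A` exceeds that of `4 * j + 1`, `j ∈ B`, by `n`. -/
def signedPairs (n : ℤ) : Set (Finset ℕ × Finset ℕ) :=
  {p | 0 ∉ p.1 ∧ (∀ a ∈ p.1, Even a) ∧ p.2 ⊆ range ((#p.1 + 1) / 2) ∧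
    ((∑ a ∈ p.1, a : ℕ) : ℤ) - ((∑ j ∈ p.2, (4 * j + 1) : ℕ) : ℤ) = n}

theorem mem_gapFamily_zero_iff {m : ℕ} {n : ℤ} {S : Finset ℕ} :
    S ∈ gapFamily m 0 n ↔
      0 ∉ S ∧ (∀ a ∈ S, Even a) ∧ #S = m ∧ ((∑ a ∈ S, a : ℕ) : ℤ) = n := by
  simp only [gapFamily, IsGapSet, Set.mem_ofPred_eq, card_eq_zero, filter_eq_empty_iff,
    Nat.not_odd_iff_even]
  constructor
  · rintro ⟨⟨h0, -⟩, hc, he, hs⟩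
    exact ⟨h0, fun a ha => he ha, hc, hs⟩
  · rintro ⟨h0, he, hc, hs⟩
    refine ⟨⟨h0, fun a ha => ⟨fun h => ?_, fun h => ?_⟩⟩, hc, he, hs⟩
    · exact Nat.not_even_iff_odd.2 (he ha).add_one (he h)
    · exact absurd (he ha) (Nat.not_even_iff_odd.2 h)

theorem card_le_of_mem_gapFamily_zero {m : ℕ} {n x : ℤ} {A B : Finset ℕ}
    (hA : A ∈ gapFamily m 0 x) (hB : B ⊆ range ((m + 1) / 2))
    (hx : x = n - ∑ j ∈ B, (-1 + -4 * (j : ℤ))) : (m : ℤ) ≤ n := by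
  by_contra! hn
  have hzero : shiftSum (-1) (-4) ((m + 1) / 2) #B (evenCount m) n = 0 := by
    refine shiftSum_evenCount_eq_zero m _ ?_
    have := Int.add_one_le_of_lt hn
    nlinarith [sq_nonneg ((m : ℤ) - 1)]
  rw [shiftSum_eq_sum, sum_eq_zero_iff] at hzero
  have h := hzero B (mem_powersetCard.2 ⟨hB, rfl⟩)
  rw [← hx, evenCount, gapCount, Set.ncard_eq_zero (gapFamily_finite _ _ _)] at h
  rw [h] at hA
  exact hA

theorem signedPairs_finite_and_ncard {n M : ℕ} (hM : n < M) :
    (signedPairs n).Finite ∧ (signedPairs n).ncard = ∑ k ∈ range M, signedCount M k n := by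
  let x (B : Finset ℕ) : ℤ := (n : ℤ) - ∑ j ∈ B, (-1 + -4 * (j : ℤ))
  have hx (B : Finset ℕ) : x B = n + ((∑ j ∈ B, (4 * j + 1) : ℕ) : ℤ) := by
    simp only [x, sub_eq_add_neg, ← sum_neg_distrib]
    push_cast
    congr 1
    exact sum_congr rfl fun j _ => by ring
  let Q : Finset (Σ _ : ℕ, Σ _ : ℕ, Σ _ : Finset ℕ, Finset ℕ) :=
    (range M).sigma fun k => (range M).sigma fun m =>
      (powersetCard k (range ((m + 1) / 2))).sigma fun B =>
        (gapFamily_finite m 0 (x B)).toFinset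
  have hQ : #Q = ∑ k ∈ range M, signedCount M k n := by
    simp only [Q, card_sigma, signedCount, shiftSum_eq_sum, evenCount, gapCount,
      Set.ncard_eq_toFinset_card _ (gapFamily_finite _ _ _), x]
  have himage : signedPairs n =
      (fun q : Σ _ : ℕ, Σ _ : ℕ, Σ _ : Finset ℕ, Finset ℕ => (q.2.2.2, q.2.2.1)) ''
        (Q : Set _) := by
    ext ⟨A, B⟩
    constructor
    · rintro ⟨h0, he, hB, hs⟩
      dsimp only at h0 he hB hs
      have hA : A ∈ gapFamily #A 0 (x B) :=
        mem_gapFamily_zero_iff.2 ⟨h0, he, rfl, by rw [hx]; omega⟩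
      have h1 := card_le_of_mem_gapFamily_zero hA hB rfl
      have h2 := card_le_card hB
      rw [card_range] at h2
      refine ⟨⟨#B, #A, B, A⟩, ?_, rfl⟩
      simp only [Q, mem_coe, mem_sigma, mem_range, Set.Finite.mem_toFinset, mem_powersetCard]
      exact ⟨by omega, by omega, ⟨hB, trivial⟩, hA⟩
    · rintro ⟨⟨k, m, B, A⟩, hq, h⟩
      obtain ⟨rfl, rfl⟩ := Prod.mk.inj h
      simp only [Q, mem_coe, mem_sigma, mem_range, Set.Finite.mem_toFinset, mem_powersetCard,
        mem_gapFamily_zero_iff] at hq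
      obtain ⟨-, -, ⟨hB, -⟩, h0, he, rfl, hs⟩ := hq
      refine ⟨h0, he, hB, ?_⟩
      rw [hx] at hs
      dsimp only
      omega
  rw [himage]
  refine ⟨Q.finite_toSet.image _, ?_⟩
  rw [Set.InjOn.ncard_image, Set.ncard_coe_finset, hQ]
  rintro ⟨k, m, B, A⟩ hA ⟨k', m', B', A'⟩ hA' h
  obtain ⟨rfl, rfl⟩ := Prod.mk.inj h
  simp only [Q, mem_coe, mem_sigma, mem_range, Set.Finite.mem_toFinset, mem_powersetCard,
    mem_gapFamily_zero_iff] at hA hA'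
  obtain ⟨-, -, ⟨-, rfl⟩, -, -, rfl, -⟩ := hA
  obtain ⟨-, -, ⟨-, rfl⟩, -, -, rfl, -⟩ := hA'
  rfl

/-- The sets of positive parts and of the numbers `b / 4`, for `b` a negative part. -/
def SignedPartition.toPair {n : ℤ} (σ : SignedPartition n) : Finset ℕ × Finset ℕ :=
  (σ.pos.parts.toFinset, σ.neg.parts.toFinset.image (· / 4))

theorem SignedPartition.ext_parts {n : ℤ} {σ τ : SignedPartition n}
    (hpos : σ.pos.parts = τ.pos.parts) (hneg : σ.neg.parts = τ.neg.parts) : σ = τ := by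
  obtain ⟨a, b, ⟨p, hp, rfl⟩, ⟨q, hq, rfl⟩, h⟩ := σ
  obtain ⟨a', b', ⟨p', hp', rfl⟩, ⟨q', hq', rfl⟩, h'⟩ := τ
  dsimp only at hpos hneg
  subst hpos hneg
  rfl

theorem four_mul_div_add_one {b : ℕ} (h : b ≡ 1 [MOD 4]) : 4 * (b / 4) + 1 = b := by
  rw [Nat.ModEq] at h
  omega

theorem image_div_four {n : ℤ} {σ : SignedPartition n} (hσ : σ ∈ LGNeg1'Set n) :
    (σ.neg.parts.toFinset.image (· / 4)).image (4 * · + 1) = σ.neg.parts.toFinset := by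
  rw [image_image]
  conv_rhs => rw [← image_id (s := σ.neg.parts.toFinset)]
  exact image_congr fun b hb => four_mul_div_add_one (hσ.2.2.2.1 b (by simpa using hb))

theorem injOn_toPair (n : ℤ) :
    Set.InjOn (SignedPartition.toPair (n := n)) (LGNeg1'Set n) := by
  intro σ hσ τ hτ h
  obtain ⟨h1, h2⟩ := Prod.mk.inj h
  refine SignedPartition.ext_parts ?_ ?_
  · rw [← hσ.1.dedup, ← hτ.1.dedup, ← Multiset.toFinset_val, ← Multiset.toFinset_val, h1]
  · rw [← hσ.2.2.1.dedup, ← hτ.2.2.1.dedup, ← Multiset.toFinset_val, ← Multiset.toFinset_val,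
      ← image_div_four hσ, ← image_div_four hτ, h2]

theorem sum_image_four_mul_add_one (B : Finset ℕ) :
    ∑ b ∈ B.image (4 * · + 1), b = ∑ j ∈ B, (4 * j + 1) :=
  sum_image fun i _ j _ (h : 4 * i + 1 = 4 * j + 1) => by omega

theorem image_toPair (n : ℤ) : SignedPartition.toPair '' LGNeg1'Set n = signedPairs n := by
  ext p
  constructor
  · rintro ⟨σ, hσ, rfl⟩
    have hcard : #σ.pos.parts.toFinset = σ.numPos := Multiset.toFinset_card_of_nodup hσ.1
    refine ⟨fun h => ?_, fun a ha => hσ.2.1 a (by simpa [SignedPartition.toPair] using ha),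
      fun j hj => ?_, ?_⟩
    · exact (σ.pos.parts_pos (by simpa [SignedPartition.toPair] using h)).ne' rfl
    · obtain ⟨b, hb, rfl⟩ := mem_image.1 hj
      rw [Multiset.mem_toFinset] at hb
      have h1 := hσ.2.2.2.2 b hb
      have h2 := four_mul_div_add_one (hσ.2.2.2.1 b hb)
      -- By parity, 4j + 1 ≤ 2m is equivalent to 2j + 1 ≤ m, that is, j < (m + 1) / 2.
      simp only [SignedPartition.toPair, hcard, mem_range]
      omega
    · rw [← sum_image_four_mul_add_one]
      simp only [SignedPartition.toPair]
      rw [image_div_four hσ, Multiset.sum_toFinset_of_nodup hσ.1,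
        Multiset.sum_toFinset_of_nodup hσ.2.2.1, σ.pos.parts_sum, σ.neg.parts_sum,
        σ.size_sub_size]
  · obtain ⟨A, B⟩ := p
    rintro ⟨h0, he, hB, hs⟩
    dsimp only at h0 he hB hs
    let σ : SignedPartition n :=
      { posSize := ∑ a ∈ A, a
        negSize := ∑ j ∈ B, (4 * j + 1)
        pos := ⟨A.val, fun {a} ha => Nat.pos_of_ne_zero fun h => h0 (h ▸ ha), by
          rw [Finset.sum, Multiset.map_id']⟩
        neg := ⟨(B.image (4 * · + 1)).val, fun {b} hb => by
          obtain ⟨j, -, rfl⟩ := mem_image.1 hb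
          exact Nat.succ_pos _, by
          rw [← sum_image_four_mul_add_one, Finset.sum, Multiset.map_id']⟩
        size_sub_size := hs }
    refine ⟨σ, ⟨A.nodup, fun a ha => he a ha, Finset.nodup _, fun b hb => ?_, fun b hb => ?_⟩, ?_⟩
    · obtain ⟨j, -, rfl⟩ := mem_image.1 hb
      rw [Nat.ModEq]
      omega
    · obtain ⟨j, hj, rfl⟩ := mem_image.1 hb
      have := mem_range.1 (hB hj)
      change 4 * j + 1 ≤ 2 * #A
      omega
    · refine Prod.ext (by simp [SignedPartition.toPair, σ]) ?_
      simp only [SignedPartition.toPair, σ, val_toFinset, image_image]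
      conv_rhs => rw [← image_id (s := B)]
      exact image_congr fun j _ => by
        simp only [Function.comp_apply, id]
        omega

theorem mainTheorem8 (n : ℕ) :
    (LGNeg1'Set (n : ℤ)).Finite ∧ LG1 n = LGNeg1' (n : ℤ) := by
  -- The cutoff must exceed `n` and be even, so that the values of `m` can be paired.
  have hM : n < 2 * (n + 1) := by omega
  obtain ⟨hfin, hcard⟩ := signedPairs_finite_and_ncard hM
  rw [← image_toPair] at hfin hcard
  refine ⟨hfin.of_finite_image (injOn_toPair n), ?_⟩
  rw [(injOn_toPair n).ncard_image] at hcard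
  rw [LGNeg1', hcard, LG1_eq_ncard_gapSets, ncard_gapSets hM]
  exact sum_congr rfl fun k _ =>
    (signedCount_eq_sum_gapCount (n + 1) k (by push_cast; omega)).symm
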